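/- Let $G$ be a graph. A configuration of $t$ pebbles on $G$ is a function $C:V(G)\to\mathbb{Z}_{\ge 0}$ with $\sum_{v}C(v)=t$. A pebbling move removes two pebbles from some vertex and places one of them on an adjacent vertex. A configuration is cover solvable if some finite (possibly empty) sequence of pebbling moves starting from it leads to a configuration with at least one pebble on every vertex simultaneously. In the Bose–Einstein model, each of the $\binom{n+t-1}{n-1}$ configurations of $t$ pebbles on the $n$ vertices of the complete graph $K_n$ is equally likely; let $P(n,t)$ denote the probability that the resulting random configuration on $K_n$ is cover solvable. Let $\gamma=(1+\sqrt5)/2$ be the golden ratio, let $\varphi:\mathbb{N}\to\mathbb{R}$ be an arbitrary function with $\varphi(n)\to\infty$ as $n\to\infty$, and let $(t_n)$ be a sequence of non-negative integers. 1. If $t_n=\gamma n+\varphi(n)\sqrt n$ for all sufficiently large $n$, then $P(n,t_n)\to1$ as $n\to\infty$. 2. If $t_n=\gamma n-\varphi(n)\sqrt n$ for all sufficiently large $n$, then $P(n,t_n)\to0$ as $n\to\infty$. Here the equations for the integers $t_n$ are understood up to rounding: it is enough that the two sides differ by less than $1$ (so equality, rounding down and rounding up are all allowed). -/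

import Mathlib

open Filter Topology MeasureTheory

namespace CoverPebbling

/-- A configuration of pebbles on the vertex set `V`: the number of pebbles on each vertex. -/
abbrev Configuration (V : Type*) := V → ℕ

/-- `PebblingMove G C D`: the configuration `D` arises from `C` by one pebbling move, that is, two
pebbles are removed from a vertex `u` and one of them is placed on a vertex `v` adjacent to `u`. -/
def PebblingMove {V : Type*} [DecidableEq V] (G : SimpleGraph V) (C D : Configuration V) : Prop :=
  ∃ u v : V, G.Adj u v ∧ 2 ≤ C u ∧ D = C - Pi.single u 2 + Pi.single v 1

/-- A configuration is cover solvable if some finite sequence of pebbling moves, starting from it,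
leads to a configuration with at least one pebble on every vertex simultaneously. -/
def CoverSolvable {V : Type*} [DecidableEq V] (G : SimpleGraph V) (C : Configuration V) : Prop :=
  ∃ D : Configuration V, Relation.ReflTransGen (PebblingMove G) C D ∧ ∀ v, 1 ≤ D v

/-- The Bose-Einstein distribution of `t` indistinguishable pebbles on `V`: the uniform
distribution on the configurations of weight `t`. -/
noncomputable def boseEinstein (V : Type*) [Fintype V] (t : ℕ) : Measure (Configuration V) :=
  ProbabilityTheory.uniformOn {C | ∑ v, C v = t}

/-- The probability that the complete graph on `n` vertices is cover solvable when `t`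
indistinguishable pebbles are placed on it according to the Bose-Einstein distribution. -/
noncomputable def probCoverSolvable (n t : ℕ) : ℝ :=
  (boseEinstein (Fin n) t).real {C | CoverSolvable (⊤ : SimpleGraph (Fin n)) C}

end CoverPebbling

/-!
On a complete graph a configuration `C` is cover solvable if and only if its `t` pebbles exceed the
number `∑ v, ⌊C v / 2⌋` of disjoint pairs of pebbles sharing a vertex by at least `n`. Splitting
`C` into the set of vertices with an odd number of pebbles and the halves of its entries shows that
`N m = n.choose (t - 2 * m) * n.multichoose m` configurations have exactly `m` such pairs. For
`t = γ n` and `m = t - n` we have `m ≈ n / γ` and `t - 2 * m ≈ n / γ ^ 2`, and there the ratio of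
consecutive `N m` is close to one because `γ ^ 2 = γ + 1`. If `t` differs from `γ n` by at least
`4 * a`, then the ratio is at most `exp (-2 * a / n)` at the `a` steps next to the threshold
`m = t - n` and beyond it. Moving a fibre `a` steps across the threshold therefore bounds the
probability of the unlikely side by `exp (-2 * a ^ 2 / n)`, which tends to zero as soon as
`a / √n → ∞`.
-/

namespace CoverPebbling

open Finset Real

section Solvability

variable {V : Type*} [Fintype V]

lemma exists_three_le_of_card_le_sum_half {C : Configuration V}
    (h : Fintype.card V ≤ ∑ v, (C v + 1) / 2) {v : V} (hv : C v = 0) : ∃ u, 3 ≤ C u := by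
  by_contra! hlt
  have : ∑ w, (C w + 1) / 2 < ∑ _w : V, 1 :=
    sum_lt_sum (fun w _ => by have := hlt w; omega) ⟨v, mem_univ v, by omega⟩
  rw [← card_eq_sum_ones, card_univ] at this
  omega

variable [DecidableEq V]

/-- The result of the pebbling move from `u` to `v`; meaningful only for `2 ≤ C u`, since the
subtraction is truncated. -/
def move (C : Configuration V) (u v : V) : Configuration V :=
  C - Pi.single u 2 + Pi.single v 1

lemma sum_comp_move {M : Type*} [AddCommMonoid M] (f : ℕ → M) (C : Configuration V) {u v : V}
    (huv : u ≠ v) :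
    ∑ w, f (move C u v w) + f (C u) + f (C v) =
      ∑ w, f (C w) + f (C u - 2) + f (C v + 1) := by
  have pointwise (w : V) : f (move C u v w) + (Pi.single u (f (C u)) : V → M) w +
        (Pi.single v (f (C v)) : V → M) w =
      f (C w) + (Pi.single u (f (C u - 2)) : V → M) w +
        (Pi.single v (f (C v + 1)) : V → M) w := by
    rcases eq_or_ne w u with rfl | hwu
    · simp [move, huv, add_comm]
    · rcases eq_or_ne w v with rfl | hwv
      · simp [move, hwu, add_comm]
      · simp [move, hwu, hwv]
  simpa [sum_add_distrib] using sum_congr rfl fun w (_ : w ∈ univ) => pointwise w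

lemma PebblingMove.sum_half_le {G : SimpleGraph V} {C D : Configuration V}
    (h : PebblingMove G C D) : ∑ v, (D v + 1) / 2 ≤ ∑ v, (C v + 1) / 2 := by
  obtain ⟨u, v, huv, hu, rfl⟩ := h
  have hsum := sum_comp_move (fun k => (k + 1) / 2) C huv.ne
  simp only [move] at hsum
  omega

lemma CoverSolvable.card_le_sum_half {G : SimpleGraph V} {C : Configuration V}
    (h : CoverSolvable G C) : Fintype.card V ≤ ∑ v, (C v + 1) / 2 := by
  obtain ⟨D, hCD, hD⟩ := h
  have hle : ∑ v, (D v + 1) / 2 ≤ ∑ v, (C v + 1) / 2 := by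
    clear hD
    induction hCD with
    | refl => exact le_rfl
    | tail _ hmove ih => exact hmove.sum_half_le.trans ih
  calc Fintype.card V = ∑ _v : V, 1 := by simp
    _ ≤ ∑ v, (D v + 1) / 2 := sum_le_sum fun v _ => by have := hD v; omega
    _ ≤ _ := hle

lemma coverSolvable_top_of_card_le_sum_half (C : Configuration V)
    (h : Fintype.card V ≤ ∑ v, (C v + 1) / 2) : CoverSolvable (⊤ : SimpleGraph V) C := by
  induction hz : #{v | C v = 0} generalizing C with
  | zero =>
    refine ⟨C, .refl, fun v => Nat.one_le_iff_ne_zero.2 fun hv => ?_⟩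
    exact filter_eq_empty_iff.1 (card_eq_zero.1 hz) (mem_univ v) hv
  | succ k ih =>
    obtain ⟨v, hv⟩ := card_pos.1 (k.succ_pos.trans_eq hz.symm)
    have hv0 : C v = 0 := (mem_filter.1 hv).2
    obtain ⟨u, hu⟩ := exists_three_le_of_card_le_sum_half h hv0
    have huv : u ≠ v := by rintro rfl; omega
    have hhalf := sum_comp_move (fun k => (k + 1) / 2) C huv
    have hempty := sum_comp_move (fun k => if k = 0 then 1 else 0) C huv
    rw [card_filter] at hz
    rw [if_neg (show C u ≠ 0 by omega), if_pos hv0, if_neg (show C u - 2 ≠ 0 by omega),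
      if_neg (C v).succ_ne_zero] at hempty
    obtain ⟨D, hD, hcover⟩ := ih (move C u v) (by omega) (by rw [card_filter]; omega)
    exact ⟨D, .head ⟨u, v, huv, by omega, rfl⟩ hD, hcover⟩

/-- The largest number of disjoint pairs of pebbles such that the two pebbles of each pair lie on
the same vertex. -/
def pairCount (C : V → ℕ) : ℕ := ∑ v, C v / 2

lemma coverSolvable_top_iff (C : Configuration V) :
    CoverSolvable (⊤ : SimpleGraph V) C ↔ pairCount C + Fintype.card V ≤ ∑ v, C v := by
  have hsum : ∑ v, C v = pairCount C + ∑ v, (C v + 1) / 2 := by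
    rw [pairCount, ← sum_add_distrib]
    exact sum_congr rfl fun v _ => by omega
  rw [hsum, add_le_add_iff_left]
  exact ⟨CoverSolvable.card_le_sum_half, coverSolvable_top_of_card_le_sum_half C⟩

end Solvability

section Counting

variable {V : Type*} [Fintype V] [DecidableEq V]

lemma card_piAntidiag_univ (m : ℕ) :
    #(piAntidiag (univ : Finset V) m) = (Fintype.card V).multichoose m := by
  rw [← map_sym_eq_piAntidiag, card_map, sym_univ, card_univ, Sym.card_sym_eq_multichoose]

/-- A configuration corresponds to the set of vertices with an odd number of pebbles and the
configuration of the halves, rounded down, of its entries. -/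
def oddHalfEquiv : Finset V × Configuration V ≃ Configuration V where
  toFun p v := 2 * p.2 v + if v ∈ p.1 then 1 else 0
  invFun C := (({v | C v % 2 = 1} : Finset V), fun v => C v / 2)
  left_inv p := by
    ext v
    · by_cases hv : v ∈ p.1 <;> simp [hv]
    · dsimp only
      split_ifs <;> omega
  right_inv C := by
    funext v
    simp only [mem_filter_univ]
    split_ifs <;> omega

lemma sum_oddHalfEquiv (p : Finset V × Configuration V) :
    ∑ v, oddHalfEquiv p v = #p.1 + 2 * ∑ v, p.2 v := by
  simp [oddHalfEquiv, sum_add_distrib, ← mul_sum, add_comm]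

lemma pairCount_oddHalfEquiv (p : Finset V × Configuration V) :
    pairCount (oddHalfEquiv p) = ∑ v, p.2 v :=
  sum_congr rfl fun v _ => congrArg (fun q => q.2 v) (oddHalfEquiv.symm_apply_apply p)

variable (V) in
/-- The configurations of `t` pebbles containing exactly `m` disjoint pairs. -/
def pairFiber (t m : ℕ) : Finset (Configuration V) :=
  {C ∈ piAntidiag univ t | pairCount C = m}

lemma card_pairFiber (x m : ℕ) :
    #(pairFiber V (x + 2 * m) m) = (Fintype.card V).choose x * (Fintype.card V).multichoose m := by
  rw [← card_univ, ← card_powersetCard, card_univ, ← card_piAntidiag_univ, ← card_product]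
  refine (card_equiv oddHalfEquiv fun p => ?_).symm
  simp only [mem_product, mem_powersetCard, subset_univ, true_and, mem_piAntidiag, mem_univ,
    implies_true, and_true, pairFiber, mem_filter, sum_oddHalfEquiv, pairCount_oddHalfEquiv]
  change _ ∧ ∑ v, p.2 v = m ↔ _
  omega

lemma pairFiber_eq_empty {t m : ℕ} (h : t < 2 * m) : pairFiber V t m = ∅ := by
  refine filter_eq_empty_iff.2 fun C hC hm => ?_
  have hle : 2 * pairCount C ≤ ∑ v, C v := by
    rw [pairCount, mul_sum]
    exact sum_le_sum fun v _ => Nat.mul_div_le _ _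
  rw [(mem_piAntidiag.1 hC).1] at hle
  omega

end Counting

section Recurrence

variable {R : Type*} [CommRing R]

lemma cast_choose_succ_mul (n k : ℕ) :
    (n.choose (k + 1) : R) * (k + 1) = n.choose k * (n - k) := by
  rcases le_or_gt k n with hkn | hnk
  · exact_mod_cast congrArg (Nat.cast : ℕ → R) (Nat.choose_succ_right_eq n k)
  · simp [Nat.choose_eq_zero_of_lt hnk, Nat.choose_eq_zero_of_lt (hnk.trans k.lt_succ_self)]

lemma succ_mul_multichoose_succ (n m : ℕ) :
    (m + 1) * n.multichoose (m + 1) = (m + n) * n.multichoose m := by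
  rcases n with _ | n
  · rcases m with _ | m <;> simp
  · rw [Nat.multichoose_eq, Nat.multichoose_eq]
    have h := Nat.add_one_mul_choose_eq (n + m) m
    rw [show n + 1 + (m + 1) - 1 = n + m + 1 by omega, show n + 1 + m - 1 = n + m by omega]
    linarith

lemma card_pairFiber_recurrence {V : Type*} [Fintype V] [DecidableEq V] (x m : ℕ) :
    ((x : R) + 1) * (x + 2) * (m + Fintype.card V) * #(pairFiber V (x + 2 * (m + 1)) m) =
      (Fintype.card V - x) * (Fintype.card V - x - 1) * (m + 1) *
        #(pairFiber V (x + 2 * (m + 1)) (m + 1)) := by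
  rw [card_pairFiber, show x + 2 * (m + 1) = x + 2 + 2 * m by ring, card_pairFiber]
  set n := Fintype.card V
  have hchoose₁ := cast_choose_succ_mul (R := R) n x
  have hchoose₂ := cast_choose_succ_mul (R := R) n (x + 1)
  have hmultichoose := congrArg (Nat.cast : ℕ → R) (succ_mul_multichoose_succ n m)
  push_cast at hchoose₂ hmultichoose ⊢
  linear_combination (m + n : R) * n.multichoose m * (x + 1) * hchoose₂ +
    (m + n : R) * n.multichoose m * (n - x - 1) * hchoose₁ -
    (n - x : R) * (n - x - 1) * n.choose x * hmultichoose

end Recurrence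

section GoldenRatio

variable {n q s : ℝ}

lemma sq_mul_add_le_of_le_mul {y : ℝ} (hn : 0 ≤ n) (hq₀ : 0 ≤ q) (hq₁ : q ≤ 1) (hy₀ : 0 ≤ y)
    (hy : y ≤ (2 - goldenRatio) * (q * n)) (hs : (goldenRatio - 1) * n ≤ s) :
    y ^ 2 * (s + n) ≤ q * ((n - y) ^ 2 * s) := by
  have hγ := goldenRatio_sq
  have hγ₁ := one_lt_goldenRatio
  have hqn : q * n ≤ n := mul_le_of_le_one_left hn hq₁
  have hs₀ : 0 ≤ s := (mul_nonneg (by linarith) hn).trans hs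
  have hsn : s + n ≤ goldenRatio ^ 2 * s := by nlinarith
  have hny : (goldenRatio - 1) * n ≤ n - y := by
    linarith [mul_le_mul_of_nonneg_left hqn (sub_nonneg.2 goldenRatio_lt_two.le)]
  have hγy : goldenRatio * y ≤ q * (n - y) := by
    calc goldenRatio * y ≤ goldenRatio * ((2 - goldenRatio) * (q * n)) :=
        mul_le_mul_of_nonneg_left hy goldenRatio_pos.le
      _ = q * ((goldenRatio - 1) * n) := by linear_combination -(q * n) * hγ
      _ ≤ q * (n - y) := by gcongr
  calc y ^ 2 * (s + n) ≤ y ^ 2 * (goldenRatio ^ 2 * s) := by gcongr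
    _ = (goldenRatio * y) ^ 2 * s := by ring
    _ ≤ (q * (n - y)) ^ 2 * s := by gcongr
    _ = q ^ 2 * ((n - y) ^ 2 * s) := by ring
    _ ≤ q * ((n - y) ^ 2 * s) := by gcongr; nlinarith

lemma sub_sq_mul_le_of_sub_le_mul {x : ℝ} (hn : 0 ≤ n) (hq₀ : 0 ≤ q) (hq₁ : q ≤ 1) (hxn : x ≤ n)
    (hx : n - x ≤ (goldenRatio - 1) * (q * n)) (hs₀ : 0 ≤ s) (hs : s ≤ (goldenRatio - 1) * n) :
    (n - x) ^ 2 * s ≤ q * (x ^ 2 * (s + n)) := by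
  have hγ := goldenRatio_sq
  have hγ₁ := one_lt_goldenRatio
  have hqn : q * n ≤ n := mul_le_of_le_one_left hn hq₁
  have hsn : goldenRatio ^ 2 * s ≤ s + n := by nlinarith
  have hxγ : (2 - goldenRatio) * n ≤ x := by
    linarith [mul_le_mul_of_nonneg_left hqn (sub_nonneg.2 hγ₁.le)]
  have hγx : n - x ≤ goldenRatio * (q * x) := by
    calc n - x ≤ (goldenRatio - 1) * (q * n) := hx
      _ = goldenRatio * (q * ((2 - goldenRatio) * n)) := by linear_combination (q * n) * hγ
      _ ≤ goldenRatio * (q * x) := by gcongr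
  calc (n - x) ^ 2 * s ≤ (goldenRatio * (q * x)) ^ 2 * s := by
        gcongr
    _ = q ^ 2 * (x ^ 2 * (goldenRatio ^ 2 * s)) := by ring
    _ ≤ q * (x ^ 2 * (s + n)) := by
      gcongr
      nlinarith

lemma sub_le_exp_neg_div_mul {x y : ℝ} (hy : 0 < y) : y - x ≤ exp (-(x / y)) * y := by
  calc y - x = (-(x / y) + 1) * y := by field_simp; ring
    _ ≤ exp (-(x / y)) * y := by gcongr; exact add_one_le_exp _

variable {x m a : ℝ}

lemma succ_mul_add_two_mul_le_exp_mul (hx₀ : 0 ≤ x) (ha : 0 ≤ a) (hxn : x + 2 < n)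
    (ht : goldenRatio * n + 4 * a ≤ x + 2 * (m + 1)) (hm : x + 2 * (m + 1) ≤ m + n + a) :
    (x + 1) * (x + 2) * (m + n) ≤
      exp (-(2 * a / n)) * ((n - x) * (n - x - 1) * (m + 1)) := by
  have hn : 0 < n := by linarith
  set q := exp (-(2 * a / n))
  have hq : n - 2 * a ≤ q * n := sub_le_exp_neg_div_mul hn
  have hq₁ : q ≤ 1 := exp_le_one_iff.2 (neg_nonpos.2 (by positivity))
  have hm₀ : 0 ≤ m + 1 := by nlinarith [one_lt_goldenRatio]
  have hx : x + 2 ≤ (2 - goldenRatio) * (q * n) := by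
    nlinarith [one_lt_goldenRatio, goldenRatio_lt_two]
  calc (x + 1) * (x + 2) * (m + n) ≤ (x + 2) * (x + 2) * (m + 1 + n) := by
        gcongr <;> linarith
    _ = (x + 2) ^ 2 * (m + 1 + n) := by ring
    _ ≤ q * ((n - (x + 2)) ^ 2 * (m + 1)) :=
      sq_mul_add_le_of_le_mul hn.le (exp_nonneg _) hq₁ (by positivity) hx (by linarith)
    _ ≤ q * ((n - x) * (n - x - 1) * (m + 1)) := by gcongr; nlinarith

lemma sub_mul_sub_one_mul_le_exp_mul (hx₀ : 0 ≤ x) (hm₀ : 0 ≤ m) (ha : 0 ≤ a) (hn : 0 < n)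
    (hxn : x ≤ n) (ht : x + 2 * (m + 1) + 4 * a ≤ goldenRatio * n)
    (hm : m + 1 + n ≤ x + 2 * (m + 1) + a) :
    (n - x) * (n - x - 1) * (m + 1) ≤
      exp (-(2 * a / n)) * ((x + 1) * (x + 2) * (m + n)) := by
  set q := exp (-(2 * a / n))
  have hq : n - 2 * a ≤ q * n := sub_le_exp_neg_div_mul hn
  have hq₁ : q ≤ 1 := exp_le_one_iff.2 (neg_nonpos.2 (by positivity))
  have hx : n - x ≤ (goldenRatio - 1) * (q * n) := by
    nlinarith [one_lt_goldenRatio, goldenRatio_lt_two]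
  calc (n - x) * (n - x - 1) * (m + 1) ≤ (n - x) ^ 2 * (m + 1) := by gcongr; nlinarith
    _ ≤ q * (x ^ 2 * (m + 1 + n)) :=
      sub_sq_mul_le_of_sub_le_mul hn.le (exp_nonneg _) hq₁ hxn hx (by positivity) (by linarith)
    _ ≤ q * ((x + 1) * (x + 2) * (m + n)) := by
      refine mul_le_mul_of_nonneg_left ?_ (exp_nonneg _)
      nlinarith [mul_nonneg hx₀ hm₀, mul_le_mul_of_nonneg_left hxn hx₀]

end GoldenRatio

section FiberRatio

variable {V : Type*} [Fintype V] [DecidableEq V] {t a m : ℕ}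

lemma le_mul_of_mul_eq_mul {b c u v q : ℝ} (hb : 0 < b) (h : b * u = c * v) (hc : c ≤ q * b)
    (hv : 0 ≤ v) : u ≤ q * v := by
  refine le_of_mul_le_mul_left ?_ hb
  calc b * u = c * v := h
    _ ≤ q * b * v := by gcongr
    _ = b * (q * v) := by ring

lemma card_pairFiber_succ_le (ht : goldenRatio * Fintype.card V + 4 * a ≤ t)
    (hm : t < m + Fintype.card V + a) :
    (#(pairFiber V t (m + 1)) : ℝ) ≤
      exp (-(2 * a / Fintype.card V)) * #(pairFiber V t m) := by
  rcases lt_or_ge t (2 * (m + 1)) with hlt | hge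
  · rw [pairFiber_eq_empty hlt, card_empty, Nat.cast_zero]
    positivity
  obtain ⟨x, rfl⟩ := Nat.exists_eq_add_of_le' hge
  have recurrence := card_pairFiber_recurrence (R := ℝ) (V := V) x m
  have hm' : (x : ℝ) + 2 * (m + 1) + 1 ≤ m + Fintype.card V + a := by exact_mod_cast hm
  push_cast at ht
  have hxn : (x : ℝ) + 2 < Fintype.card V := by
    nlinarith [one_lt_goldenRatio, (Fintype.card V).cast_nonneg (α := ℝ)]
  have hweight := succ_mul_add_two_mul_le_exp_mul x.cast_nonneg a.cast_nonneg hxn ht (by linarith)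
  refine le_mul_of_mul_eq_mul ?_ recurrence.symm hweight (Nat.cast_nonneg _)
  exact mul_pos (mul_pos (by linarith) (by linarith)) m.cast_add_one_pos

lemma card_pairFiber_le_succ [Nonempty V] (ht : t + 4 * a ≤ goldenRatio * Fintype.card V)
    (hm : m + 1 + Fintype.card V ≤ t + a) :
    (#(pairFiber V t m) : ℝ) ≤
      exp (-(2 * a / Fintype.card V)) * #(pairFiber V t (m + 1)) := by
  have hn : (0 : ℝ) < Fintype.card V := by exact_mod_cast Fintype.card_pos
  have hm' : (m : ℝ) + 1 + Fintype.card V ≤ t + a := by exact_mod_cast hm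
  have hge : 2 * (m + 1) ≤ t := by
    have : (2 * (m + 1) : ℝ) ≤ t := by nlinarith [goldenRatio_lt_two]
    exact_mod_cast this
  obtain ⟨x, rfl⟩ := Nat.exists_eq_add_of_le' hge
  rcases lt_or_ge (Fintype.card V) x with hnx | hxn
  · rw [show x + 2 * (m + 1) = x + 2 + 2 * m by ring, card_pairFiber,
      Nat.choose_eq_zero_of_lt (show Fintype.card V < x + 2 by omega), zero_mul, Nat.cast_zero]
    positivity
  have recurrence := card_pairFiber_recurrence (R := ℝ) (V := V) x m
  push_cast at ht hm'
  have hweight := sub_mul_sub_one_mul_le_exp_mul x.cast_nonneg m.cast_nonneg a.cast_nonneg hn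
    (by exact_mod_cast hxn) ht hm'
  exact le_mul_of_mul_eq_mul (by positivity) recurrence hweight (Nat.cast_nonneg _)

end FiberRatio

section FiberTransport

variable {R : Type*} [CommSemiring R] [PartialOrder R] [IsOrderedRing R]

lemma le_pow_mul_iterate {κ : Type*} {N : κ → R} {g : κ → κ} {r : R} (hr : 0 ≤ r) {x : κ} {a : ℕ}
    (h : ∀ j < a, N (g^[j] x) ≤ r * N (g^[j + 1] x)) : N x ≤ r ^ a * N (g^[a] x) := by
  induction a with
  | zero => simp
  | succ a ih =>
    calc N x ≤ r ^ a * N (g^[a] x) := ih fun j hj => h j (hj.trans a.lt_succ_self)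
      _ ≤ r ^ a * (r * N (g^[a + 1] x)) := by gcongr; exact h a a.lt_succ_self
      _ = r ^ (a + 1) * N (g^[a + 1] x) := by ring

lemma card_filter_le_mul_card {ι κ : Type*} [DecidableEq κ] (S : Finset ι) (f : ι → κ)
    {p : κ → Prop} [DecidablePred p] {g : κ → κ} (hg : Set.InjOn g {m | p m}) {r : R} (hr : 0 ≤ r)
    (h : ∀ m, p m → (#{C ∈ S | f C = m} : R) ≤ r * #{C ∈ S | f C = g m}) :
    (#{C ∈ S | p (f C)} : R) ≤ r * #S := by
  set T := {m ∈ S.image f | p m} with hT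
  have source : #{C ∈ S | p (f C)} = ∑ m ∈ T, #{C ∈ S | f C = m} := by
    rw [sum_card_fiberwise_eq_card_filter]
    exact congrArg card (filter_congr fun C hC => by simp [hT, mem_image_of_mem f hC])
  have target : ∑ m ∈ T, #{C ∈ S | f C = g m} ≤ #S := by
    have hinj : Set.InjOn g T := hg.mono fun m hm => (mem_filter.1 hm).2
    rw [← sum_image (f := fun m => #{C ∈ S | f C = m}) hinj, sum_card_fiberwise_eq_card_filter]
    exact card_filter_le _ _
  calc (#{C ∈ S | p (f C)} : R) = ∑ m ∈ T, (#{C ∈ S | f C = m} : R) := by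
        rw [source, Nat.cast_sum]
    _ ≤ ∑ m ∈ T, r * (#{C ∈ S | f C = g m} : R) :=
      sum_le_sum fun m hm => h m (mem_filter.1 hm).2
    _ = r * ((∑ m ∈ T, #{C ∈ S | f C = g m} : ℕ) : R) := by rw [← mul_sum, Nat.cast_sum]
    _ ≤ r * #S := by gcongr

end FiberTransport

section Probability

variable {V : Type*} [Fintype V]

instance (t : ℕ) : IsZeroOrProbabilityMeasure (boseEinstein V t) :=
  inferInstanceAs (IsZeroOrProbabilityMeasure (ProbabilityTheory.uniformOn _))

lemma coe_piAntidiag_univ [DecidableEq V] (t : ℕ) :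
    (piAntidiag (univ : Finset V) t : Set (Configuration V)) = {C | ∑ v, C v = t} := by
  ext; simp

instance [Nonempty V] (t : ℕ) : IsProbabilityMeasure (boseEinstein V t) := by
  classical
  rw [boseEinstein, ← coe_piAntidiag_univ]
  refine ProbabilityTheory.isProbabilityMeasure_uniformOn (finite_toSet _) ?_
  exact ⟨Pi.single (Classical.arbitrary V) t, by simp⟩

variable [DecidableEq V]

lemma boseEinstein_real_setOf (t : ℕ) (p : Configuration V → Prop) [DecidablePred p] :
    (boseEinstein V t).real {C | p C} =
      #{C ∈ piAntidiag univ t | p C} / #(piAntidiag (univ : Finset V) t) := by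
  have hset : ((piAntidiag univ t : Finset (V → ℕ)) : Set (V → ℕ)) ∩ {C | p C} =
      ({C ∈ piAntidiag univ t | p C} : Finset (V → ℕ)) := by
    ext; simp
  rw [boseEinstein, ← coe_piAntidiag_univ, measureReal_def,
    ← ProbabilityTheory.uniformOn_inter_self (finite_toSet _), hset,
    ProbabilityTheory.uniformOn_apply_finset, inter_eq_right.2 (filter_subset _ _)]
  simp

lemma boseEinstein_real_coverSolvable (t : ℕ) :
    (boseEinstein V t).real {C | CoverSolvable (⊤ : SimpleGraph V) C} =
      (boseEinstein V t).real {C | pairCount C + Fintype.card V ≤ t} := by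
  classical
  rw [boseEinstein_real_setOf, boseEinstein_real_setOf]
  congr 3
  refine filter_congr fun C hC => ?_
  rw [coverSolvable_top_iff, (mem_piAntidiag.1 hC).1]

lemma boseEinstein_real_pairCount_le_pow {t a : ℕ} {p : ℕ → Prop} {g : ℕ → ℕ} {r : ℝ} (hr : 0 ≤ r)
    (hg : Set.InjOn g^[a] {m | p m})
    (h : ∀ m, p m → ∀ j < a,
      (#(pairFiber V t (g^[j] m)) : ℝ) ≤ r * #(pairFiber V t (g^[j + 1] m))) :
    (boseEinstein V t).real {C | p (pairCount C)} ≤ r ^ a := by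
  classical
  rw [boseEinstein_real_setOf]
  refine div_le_of_le_mul₀ (Nat.cast_nonneg _) (by positivity) ?_
  exact card_filter_le_mul_card _ pairCount hg (by positivity) fun m hm =>
    le_pow_mul_iterate (N := fun m => (#(pairFiber V t m) : ℝ)) hr (h m hm)

lemma exp_neg_two_mul_div_pow (a : ℕ) (x : ℝ) :
    exp (-(2 * a / x)) ^ a = exp (-(2 * (a ^ 2 / x))) := by
  rw [← exp_nat_mul]
  ring_nf

variable [Nonempty V] {t a : ℕ}

lemma boseEinstein_real_coverSolvable_le (ht : t + 4 * a ≤ goldenRatio * Fintype.card V) :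
    (boseEinstein V t).real {C | CoverSolvable (⊤ : SimpleGraph V) C} ≤
      exp (-(2 * (a ^ 2 / Fintype.card V))) := by
  rw [boseEinstein_real_coverSolvable, ← exp_neg_two_mul_div_pow]
  refine boseEinstein_real_pairCount_le_pow (p := fun m => m + Fintype.card V ≤ t) (g := Nat.succ)
    (exp_nonneg _) (Nat.succ_injective.iterate a).injOn fun m hm j hj => ?_
  rw [Nat.succ_iterate, Nat.succ_iterate]
  exact card_pairFiber_le_succ ht (by omega)

lemma le_boseEinstein_real_coverSolvable (ht : goldenRatio * Fintype.card V + 4 * a ≤ t) :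
    1 - exp (-(2 * (a ^ 2 / Fintype.card V))) ≤
      (boseEinstein V t).real {C | CoverSolvable (⊤ : SimpleGraph V) C} := by
  have hat : Fintype.card V + a ≤ t := by
    have : (Fintype.card V + a : ℝ) ≤ t := by
      nlinarith [one_lt_goldenRatio, (Fintype.card V).cast_nonneg (α := ℝ), a.cast_nonneg (α := ℝ)]
    exact_mod_cast this
  have htail : (boseEinstein V t).real {C | pairCount C + Fintype.card V ≤ t}ᶜ ≤
      exp (-(2 * a / Fintype.card V)) ^ a := by
    refine boseEinstein_real_pairCount_le_pow (p := fun m => ¬ m + Fintype.card V ≤ t)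
      (g := Nat.pred) (exp_nonneg _) (fun m hm m' hm' h => ?_) fun m hm j hj => ?_
    · rw [Nat.pred_iterate, Nat.pred_iterate] at h
      simp only [Set.mem_ofPred_eq] at hm hm'
      omega
    · rw [Nat.pred_iterate, Nat.pred_iterate, show m - j = m - (j + 1) + 1 by omega]
      exact card_pairFiber_succ_le ht (by omega)
  rw [probReal_compl_eq_one_sub (Set.to_countable _).measurableSet,
    exp_neg_two_mul_div_pow] at htail
  rw [boseEinstein_real_coverSolvable]
  linarith

end Probability

section Limit

lemma tendsto_exp_neg_two_mul_floor_sq_div {d : ℕ → ℝ}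
    (hd : Tendsto (fun n : ℕ => d n / √(n : ℝ)) atTop atTop) :
    Tendsto (fun n : ℕ => exp (-(2 * ((⌊d n / 4⌋₊ : ℝ) ^ 2 / n)))) atTop (𝓝 0) := by
  have hfloor : Tendsto (fun n : ℕ => (⌊d n / 4⌋₊ : ℝ) / √(n : ℝ)) atTop atTop := by
    refine tendsto_atTop_mono' _ ?_
      (tendsto_atTop_add_const_right _ (-1) (hd.atTop_div_const (show (0 : ℝ) < 4 by norm_num)))
    filter_upwards [eventually_gt_atTop 0] with n hn
    have hsqrt : 1 ≤ √(n : ℝ) := one_le_sqrt.2 (by exact_mod_cast hn)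
    rw [le_div_iff₀ (by positivity)]
    calc (d n / √(n : ℝ) / 4 + -1) * √(n : ℝ) = d n / 4 - √(n : ℝ) := by field_simp; ring
      _ ≤ ⌊d n / 4⌋₊ := by linarith [Nat.lt_floor_add_one (d n / 4)]
  have hsq := ((tendsto_pow_atTop two_ne_zero).comp hfloor).const_mul_atTop two_pos
  refine (tendsto_exp_neg_atTop_nhds_zero.comp hsq).congr fun n => ?_
  simp only [Function.comp_apply, div_pow, sq_sqrt n.cast_nonneg]

lemma eventually_four_mul_floor_le {d : ℕ → ℝ}
    (hd : Tendsto (fun n : ℕ => d n / √(n : ℝ)) atTop atTop) :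
    ∀ᶠ n in atTop, 4 * (⌊d n / 4⌋₊ : ℝ) ≤ d n := by
  filter_upwards [hd.eventually_gt_atTop 0] with n hn
  have hd₀ : 0 ≤ d n := by
    by_contra! hneg
    exact hn.not_ge (div_nonpos_of_nonpos_of_nonneg hneg.le (sqrt_nonneg _))
  linarith [Nat.floor_le (show 0 ≤ d n / 4 by positivity)]

variable {t : ℕ → ℕ}

lemma tendsto_probCoverSolvable_one
    (ht : Tendsto (fun n : ℕ => (t n - goldenRatio * n) / √(n : ℝ)) atTop atTop) :
    Tendsto (fun n => probCoverSolvable n (t n)) atTop (𝓝 1) := by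
  have hlim := (tendsto_exp_neg_two_mul_floor_sq_div ht).const_sub 1
  rw [sub_zero] at hlim
  refine tendsto_of_tendsto_of_tendsto_of_le_of_le' hlim tendsto_const_nhds ?_
    (.of_forall fun n => measureReal_le_one)
  filter_upwards [eventually_gt_atTop 0, eventually_four_mul_floor_le ht] with n hn hfloor
  have : NeZero n := ⟨hn.ne'⟩
  have hle := le_boseEinstein_real_coverSolvable (V := Fin n) (t := t n)
    (a := ⌊(t n - goldenRatio * n) / 4⌋₊) (by rw [Fintype.card_fin]; linarith)
  rwa [Fintype.card_fin] at hle

lemma tendsto_probCoverSolvable_zero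
    (ht : Tendsto (fun n : ℕ => (t n - goldenRatio * n) / √(n : ℝ)) atTop atBot) :
    Tendsto (fun n => probCoverSolvable n (t n)) atTop (𝓝 0) := by
  have ht' : Tendsto (fun n : ℕ => (goldenRatio * n - t n) / √(n : ℝ)) atTop atTop :=
    (tendsto_neg_atBot_atTop.comp ht).congr fun n => by rw [Function.comp_apply]; ring
  refine tendsto_of_tendsto_of_tendsto_of_le_of_le' tendsto_const_nhds
    (tendsto_exp_neg_two_mul_floor_sq_div ht') (.of_forall fun n => measureReal_nonneg) ?_
  filter_upwards [eventually_gt_atTop 0, eventually_four_mul_floor_le ht'] with n hn hfloor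
  have : NeZero n := ⟨hn.ne'⟩
  have hle := boseEinstein_real_coverSolvable_le (V := Fin n) (t := t n)
    (a := ⌊(goldenRatio * n - t n) / 4⌋₊) (by rw [Fintype.card_fin]; linarith)
  rwa [Fintype.card_fin] at hle

lemma abs_div_sqrt_sub_lt_one {x c d : ℝ} (hx : 1 ≤ x) (h : |d - c * √x| < 1) :
    |d / √x - c| < 1 := by
  have hsqrt : 1 ≤ √x := one_le_sqrt.2 hx
  have hpos : 0 < √x := by positivity
  rw [div_sub' hpos.ne', mul_comm, abs_div, abs_of_pos hpos, div_lt_one hpos]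
  exact h.trans_le hsqrt

end Limit

end CoverPebbling

theorem theorem6 (φ : ℕ → ℝ) (hφ : Tendsto φ atTop atTop) (t : ℕ → ℕ) :
    ((∀ᶠ n : ℕ in atTop, |(t n : ℝ) - (Real.goldenRatio * n + φ n * √(n : ℝ))| < 1) →
      Tendsto (fun n => CoverPebbling.probCoverSolvable n (t n)) atTop (𝓝 1)) ∧
    ((∀ᶠ n : ℕ in atTop, |(t n : ℝ) - (Real.goldenRatio * n - φ n * √(n : ℝ))| < 1) →
      Tendsto (fun n => CoverPebbling.probCoverSolvable n (t n)) atTop (𝓝 0)) := by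
  constructor <;> intro ht
  · apply CoverPebbling.tendsto_probCoverSolvable_one
    refine tendsto_atTop_mono' _ ?_ (tendsto_atTop_add_const_right _ (-1) hφ)
    filter_upwards [ht, eventually_ge_atTop 1] with n htn hn
    have hscaled := CoverPebbling.abs_div_sqrt_sub_lt_one (x := n) (c := φ n)
      (d := t n - Real.goldenRatio * n) (by exact_mod_cast hn) (by rwa [sub_sub])
    linarith [(abs_lt.1 hscaled).1]
  · apply CoverPebbling.tendsto_probCoverSolvable_zero
    refine tendsto_atBot_mono' _ ?_
      (tendsto_atBot_add_const_right _ 1 (tendsto_neg_atTop_atBot.comp hφ))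
    filter_upwards [ht, eventually_ge_atTop 1] with n htn hn
    have hscaled := CoverPebbling.abs_div_sqrt_sub_lt_one (x := n) (c := -φ n)
      (d := t n - Real.goldenRatio * n) (by exact_mod_cast hn)
      (by rwa [sub_sub, neg_mul, ← sub_eq_add_neg])
    rw [Function.comp_apply]
    linarith [(abs_lt.1 hscaled).2]
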